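/- For $\alpha>0$ let $\mathcal T_\alpha$ be the random rooted tree obtained as follows. Take a path (the spine) with vertices $v_0,\dots,v_{L-1}$, where the number $L\ge 1$ of its vertices is geometric with parameter $\frac{\alpha}{1+\alpha}$, that is, $\mathbb P(L=k+1)=\frac{\alpha}{(1+\alpha)^{k+1}}$ for $k\ge 0$; on each spine vertex $v_i$ grow a Bienaymé–Galton–Watson tree with root $v_i$ and $\mathrm{Poisson}\big(\frac1{1+\alpha}\big)$ reproduction law, these trees being independent of each other and of $L$; the root of $\mathcal T_\alpha$ is $\mathbf o=v_0$. For $\alpha=0$ let $\mathcal T_0$ be the tree obtained in the same way from an infinite spine ($L=\infty$), with reproduction law $\mathrm{Poisson}(1)$. For a rooted tree $T$ and an integer $h\ge 0$, let $T_{\le h}$ be the subtree induced on the vertices at distance at most $h$ from the root, and let $|T|$, $|T_h|$ and $|T_{<h}|$ be the numbers of all vertices, of vertices at distance exactly $h$, and of vertices at distance less than $h$ from the root. Let $\mathrm{Aut}(T)$ be the group of graph automorphisms of $T$ that fix the root, and let $\mathrm{Shape}(T,\mathbf o)$ be the unlabeled (non-planar) rooted tree defined by $T$, that is, its isomorphism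 class as a rooted tree. **Proposition.** Let $\alpha\ge 0$, let $h\ge 0$ be an integer, and let $t$ be a finite unlabeled rooted tree of height at most $h$. Then $\{\mathrm{Shape}(\mathcal T_\alpha,\mathbf o)_{\le h}=t\}$ is an event, and $$\mathbb P\big(\mathrm{Shape}(\mathcal T_\alpha,\mathbf o)_{\le h}=t\big)=\frac{|t_h|+\alpha|t|}{|\mathrm{Aut}(t)|}\,\frac{1}{(1+\alpha)^{|t|}}\,\exp\Big(-\frac{|t_{<h}|}{1+\alpha}\Big).$$ -/

import Mathlib

open MeasureTheory ProbabilityTheory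
open scoped NNReal ENNReal

universe u v

/-- A graph with a distinguished vertex, its root. -/
structure RootedGraph : Type (u + 1) where
  /-- the vertices -/
  V : Type u
  /-- the underlying simple graph -/
  graph : SimpleGraph V
  /-- the root -/
  root : V

namespace RootedGraph

/-- Isomorphisms of rooted graphs: graph isomorphisms that map the root to the root. -/
def Iso (G : RootedGraph.{u}) (H : RootedGraph.{v}) : Type (max u v) :=
  {φ : G.graph ≃g H.graph // φ G.root = H.root}

/-- `G` and `H` have the same shape, i.e. they represent the same unlabeled rooted graph. -/
def SameShape (G : RootedGraph.{u}) (H : RootedGraph.{v}) : Prop :=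
  Nonempty (Iso G H)

/-- The set of graph automorphisms that preserve the root. -/
abbrev Aut (G : RootedGraph.{u}) : Type u :=
  Iso G G

/-- Graph distance to the root (`⊤` for vertices that are not connected to the root). -/
noncomputable def height (G : RootedGraph.{u}) (x : G.V) : ℕ∞ :=
  G.graph.edist G.root x

/-- The set `T_h` of the vertices at distance exactly `h` from the root. -/
def level (G : RootedGraph.{u}) (h : ℕ) : Set G.V :=
  {x | G.height x = h}

/-- The vertices of `T_{<h}`, those at distance less than `h` from the root. -/
def below (G : RootedGraph.{u}) (h : ℕ) : Set G.V :=
  {x | G.height x < h}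

/-- The closed ball of radius `h` about the root. -/
def ball (G : RootedGraph.{u}) (h : ℕ) : Set G.V :=
  {x | G.height x ≤ h}

/-- `T_{≤ h}`: the intersection of `T` with the closed ball of radius `h` about the root. -/
def trunc (G : RootedGraph.{u}) (h : ℕ) : RootedGraph.{u} where
  V := G.ball h
  graph := G.graph.induce (G.ball h)
  root := ⟨G.root, by simp [ball, height]⟩

end RootedGraph

/-- The individuals, in Ulam-Harris notation, of the family tree in which the individual `w` has
`ξ w` children: the `k`-th child of `w` is `w ++ [k]`, with `0 ≤ k < ξ w`, and the word `w` is an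
individual when each step from a prefix of `w` to the next one leads to an existing child. -/
def familyTree (ξ : List ℕ → ℕ) : Set (List ℕ) :=
  {w | ∀ (x : List ℕ) (k : ℕ), x ++ [k] <+: w → k < ξ x}

/-- `(i, w)` denotes the individual `w` of the family tree grown on the `i`-th spine vertex; the
spine vertex itself is `(i, [])`. The relation says that `q` is a child of `p`: either within the
same family tree, or as the spine vertex that follows `p`. -/
def IsChild (p q : ℕ × List ℕ) : Prop :=
  (q.1 = p.1 ∧ ∃ k : ℕ, q.2 = p.2 ++ [k]) ∨ (q.1 = p.1 + 1 ∧ p.2 = [] ∧ q.2 = [])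

/-- The individuals of the family trees of `ξ i` grown on the spine vertices `i ≤ K`. -/
def spineVertices (ξ : ℕ → List ℕ → ℕ) (K : ℕ∞) : Set (ℕ × List ℕ) :=
  {p | (p.1 : ℕ∞) ≤ K ∧ p.2 ∈ familyTree (ξ p.1)}

/-- The tree with spine vertices `i = 0, …, K` (all `i : ℕ` if `K = ⊤`), rooted at the spine
vertex `0`, with the family tree of `ξ i` grown on the spine vertex `i`. -/
def spineTree (ξ : ℕ → List ℕ → ℕ) (K : ℕ∞) : RootedGraph.{0} where
  V := spineVertices ξ K
  graph := (SimpleGraph.fromRel IsChild).induce (spineVertices ξ K)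
  root := ⟨(0, []), by simp [spineVertices, familyTree]⟩

/-- The law of the offspring numbers in a Bienaymé-Galton-Watson tree with reproduction law
Poisson of mean `β`: independent Poisson numbers, one for each Ulam-Harris word. -/
noncomputable def bgwpLaw (β : ℝ≥0) : Measure (List ℕ → ℕ) :=
  Measure.infinitePi fun _ => poissonMeasure β

instance (β : ℝ≥0) : IsProbabilityMeasure (bgwpLaw β) := by
  unfold bgwpLaw
  infer_instance

/-- The parameter `α / (1 + α)`. -/
noncomputable def spineParam (α : ℝ≥0) : unitInterval :=
  ⟨(α : ℝ) / (1 + α), by positivity, by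
    rw [div_le_one (by positivity)]
    linarith⟩

open Classical in
/-- The law of the index `K` of the last spine vertex, so that `K + 1` is the size of the spine:
`P(K = k) = (1 - p) ^ k * p` with `p = α / (1 + α)` if `α > 0`, and `K = ⊤` if `α = 0`. -/
noncomputable def spineLaw (α : ℝ≥0) : Measure ℕ∞ :=
  if α = 0 then Measure.dirac ⊤
  else (geometricMeasure (spineParam α)).map (fun k : ℕ => (k : ℕ∞))

instance (α : ℝ≥0) : IsProbabilityMeasure (spineLaw α) := by
  unfold spineLaw
  split_ifs
  · infer_instance
  · exact Measure.isProbabilityMeasure_map (by fun_prop)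

/-- The probability measure under which `(ξ, K) ↦ spineTree ξ K` is the random tree `T_α`: the
family trees are independent with law `BGWP(1 / (1 + α))`, and independent of the spine. -/
noncomputable def spineTreeLaw (α : ℝ≥0) : Measure ((ℕ → List ℕ → ℕ) × ℕ∞) :=
  (Measure.infinitePi fun _ : ℕ => bgwpLaw (1 / (1 + α))).prod (spineLaw α)

/-! The proof computes the expected number of isomorphisms from `t` to the truncated random tree.
There are `|Aut t|` of them when the shapes agree and none otherwise, so this expectation is `|Aut
t|` times the required probability.

Put `β = 1 / (1 + α)`. An isomorphism amounts to a labelling of `t` by individuals of the spine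
tree. It is encoded by the vertex `v` of `t` sent to the last spine vertex in the ball, together
with an enumeration `r` of the children of each vertex off the path to `v`. Conversely, every pair
`(v, r)` gives a labelling `label r`, which is an isomorphism exactly on `labelEvent`: the labelled
individuals of generation less than `h` have the offspring numbers `c x` read off from `t`, and the
spine leaves the ball at the height of `v` (`natCard_iso_eq`).

By independence this event has probability `β ^ |t| * exp (-β * |t_{<h}|) / ∏ (c x)!`, times `1 + α`
if `v` has height `h` and `α` otherwise (`spineTreeLaw_labelEvent`). There are `∏ (c x)!`
enumerations for each `v`, so the factorials cancel, and summing the last factor over `v` gives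
`|t_h| + α |t|`. -/

namespace RootedGraph

/-! ### Rooted trees described by parents and generations -/

lemma edist_hom_le {V : Type u} {W : Type v} {S : SimpleGraph V} {T : SimpleGraph W} (f : S →g T)
    (x y : V) : T.edist (f x) (f y) ≤ S.edist x y := by
  by_cases hr : S.Reachable x y
  · obtain ⟨w, hw⟩ := hr.exists_walk_length_eq_edist
    rw [← hw, ← SimpleGraph.Walk.length_map f w]
    exact SimpleGraph.edist_le _
  · rw [SimpleGraph.edist_eq_top_of_not_reachable hr]
    exact le_top

lemma Iso.height_eq {G : RootedGraph.{u}} {H : RootedGraph.{v}} (φ : G.Iso H) (x : G.V) :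
    H.height (φ.1 x) = G.height x := by
  obtain ⟨φ, hr⟩ := φ
  change H.graph.edist H.root (φ x) = G.graph.edist G.root x
  rw [← hr]
  refine le_antisymm (edist_hom_le φ.toHom _ _) ?_
  have := edist_hom_le φ.symm.toHom (φ G.root) (φ x)
  have e : ∀ y, φ.symm.toHom (φ y) = y := fun y => φ.symm_apply_apply y
  rwa [e, e] at this

/-- A parent function and a generation function that exhibit a rooted graph as a rooted tree. The
root is its own parent. -/
structure Parents (G : RootedGraph.{u}) where
  /-- the parent of a vertex -/
  par : G.V → G.V
  /-- the generation of a vertex -/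
  ht : G.V → ℕ
  par_root : par G.root = G.root
  ht_root : ht G.root = 0
  ht_eq : ∀ x, x ≠ G.root → ht x = ht (par x) + 1
  adj_iff : ∀ x y, G.graph.Adj x y ↔ x ≠ y ∧ (par x = y ∨ par y = x)

namespace Parents

variable {G : RootedGraph.{u}} (P : G.Parents)

include P

lemma ht_eq_zero_iff {x : G.V} : P.ht x = 0 ↔ x = G.root := by
  refine ⟨fun h => ?_, fun h => h ▸ P.ht_root⟩
  by_contra hx
  have := P.ht_eq x hx
  omega

lemma ht_par (x : G.V) : P.ht (P.par x) = P.ht x - 1 := by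
  by_cases hx : x = G.root
  · subst hx; rw [P.par_root, P.ht_root]
  · rw [P.ht_eq x hx]; rfl

lemma adj_par {x : G.V} (hx : x ≠ G.root) : G.graph.Adj (P.par x) x := by
  rw [P.adj_iff]
  refine ⟨fun h => ?_, Or.inr rfl⟩
  have := P.ht_eq x hx
  rw [h] at this
  omega

lemma par_of_adj {x y : G.V} (hxy : G.graph.Adj x y) (h : P.ht y = P.ht x + 1) : P.par y = x := by
  obtain ⟨-, h' | h'⟩ := (P.adj_iff x y).1 hxy
  · have := P.ht_par x
    rw [h'] at this
    omega
  · exact h'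

lemma ht_le_of_adj {x y : G.V} (hxy : G.graph.Adj x y) : P.ht y ≤ P.ht x + 1 := by
  obtain ⟨-, h | h⟩ := (P.adj_iff x y).1 hxy
  · rw [← h, P.ht_par]; omega
  · rw [← h, P.ht_par]; omega

/-- Induction from the root upwards. -/
lemma induction {motive : G.V → Prop} (root : motive G.root)
    (step : ∀ x, x ≠ G.root → motive (P.par x) → motive x) (x : G.V) : motive x := by
  induction hn : P.ht x generalizing x with
  | zero => exact (P.ht_eq_zero_iff.1 hn) ▸ root
  | succ n ih =>
    have hx : x ≠ G.root := by rintro rfl; rw [P.ht_root] at hn; omega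
    exact step x hx (ih _ (by rw [P.ht_par, hn]; rfl))

/-- Following parents gives a walk of length `P.ht x` to the root, and no walk is shorter because
the generation changes by at most one along an edge. -/
lemma height_eq (x : G.V) : G.height x = P.ht x := by
  apply le_antisymm
  · refine P.induction (motive := fun x => G.height x ≤ P.ht x) ?_ ?_ x
    · simp [height]
    · intro x hx ih
      have h1 : G.graph.edist G.root x ≤
          G.graph.edist G.root (P.par x) + G.graph.edist (P.par x) x :=
        SimpleGraph.edist_triangle
      rw [SimpleGraph.edist_eq_one_iff_adj.2 (P.adj_par hx)] at h1
      rw [P.ht_eq x hx]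
      push_cast
      exact h1.trans (add_le_add_left ih 1)
  · have key : ∀ (y z : G.V) (w : G.graph.Walk y z), P.ht z ≤ P.ht y + w.length := by
      intro y z w
      induction w with
      | nil => simp
      | cons hadj w ih =>
        have := P.ht_le_of_adj hadj
        rw [SimpleGraph.Walk.length_cons]
        omega
    unfold height
    by_cases hr : G.graph.Reachable G.root x
    · obtain ⟨w, hw⟩ := hr.exists_walk_length_eq_edist
      rw [← hw]
      have := key _ _ w
      rw [P.ht_root, zero_add] at this
      exact_mod_cast this
    · rw [SimpleGraph.edist_eq_top_of_not_reachable hr]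
      exact le_top

variable {H : RootedGraph.{v}} (Q : H.Parents)

include Q

lemma iso_ht (φ : G.Iso H) (x : G.V) : Q.ht (φ.1 x) = P.ht x := by
  have := φ.height_eq x
  rw [P.height_eq, Q.height_eq] at this
  exact_mod_cast this

/-- Isomorphisms preserve generations, and the parent is the only neighbour one generation closer to
the root. -/
lemma iso_par (φ : G.Iso H) (x : G.V) : φ.1 (P.par x) = Q.par (φ.1 x) := by
  by_cases hx : x = G.root
  · subst hx
    rw [P.par_root, φ.2, Q.par_root]
  · refine (Q.par_of_adj (φ.1.map_adj_iff.2 (P.adj_par hx)) ?_).symm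
    rw [P.iso_ht Q, P.iso_ht Q, P.ht_eq x hx]

/-- A bijection that respects roots and parents is an isomorphism. -/
noncomputable def iso (g : G.V → H.V) (hg : Function.Bijective g) (hr : g G.root = H.root)
    (hp : ∀ x, g (P.par x) = Q.par (g x)) : G.Iso H :=
  ⟨⟨Equiv.ofBijective g hg, by
    intro x y
    rw [P.adj_iff, Q.adj_iff]
    simp only [Equiv.ofBijective_apply, ← hp, hg.1.eq_iff, ne_eq]⟩, hr⟩

omit Q

lemma par_mem_ball {h : ℕ} {x : G.V} (hx : x ∈ G.ball h) : P.par x ∈ G.ball h := by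
  simp only [ball, Set.mem_ofPred_eq, P.height_eq, P.ht_par] at hx ⊢
  exact le_trans (by exact_mod_cast Nat.sub_le _ _) hx

/-- A truncation inherits parents. -/
noncomputable def trunc (h : ℕ) : (G.trunc h).Parents where
  par x := ⟨P.par x.1, P.par_mem_ball x.2⟩
  ht x := P.ht x.1
  par_root := Subtype.ext P.par_root
  ht_root := P.ht_root
  ht_eq x hx := P.ht_eq x.1 fun h => hx (Subtype.ext h)
  adj_iff x y := by
    have := P.adj_iff x.1 y.1
    have e : ∀ a b : (G.trunc h).V, a = b ↔ a.1 = b.1 := fun _ _ => Subtype.ext_iff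
    exact this.trans (and_congr (not_congr (e x y)) 
      (or_congr (e ⟨_, P.par_mem_ball x.2⟩ y) (e ⟨_, P.par_mem_ball y.2⟩ x))).symm

end Parents

/-- Existence: the penultimate vertex of a geodesic. Uniqueness: a geodesic to any such `y`,
extended by the edge to `x`, is again a path, and a tree has only one path from `o` to `x`. -/
lemma existsUnique_adj_dist_of_isTree {V : Type u} {T : SimpleGraph V} (hT : T.IsTree) (o x : V)
    (hx : x ≠ o) : ∃! y, T.Adj y x ∧ T.dist o x = T.dist o y + 1 := by
  obtain ⟨p, hp, hl⟩ := hT.connected.exists_path_of_dist o x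
  have hnil : ¬ p.Nil := fun h => hx h.eq.symm
  have hadj : T.Adj p.penultimate x := p.adj_penultimate hnil
  refine ⟨p.penultimate, ⟨hadj, ?_⟩, ?_⟩
  · have h1 : T.dist o p.penultimate ≤ p.dropLast.length := SimpleGraph.dist_le _
    have h2 : p.dropLast.length + 1 = p.length := SimpleGraph.Walk.length_dropLast_add_one hnil
    have h3 := hT.dist_eq_dist_add_one_of_adj o hadj
    omega
  · rintro y ⟨hy, hd⟩
    obtain ⟨q, hq, hql⟩ := hT.connected.exists_path_of_dist o y
    have hc : (q.concat hy).IsPath := by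
      apply SimpleGraph.Walk.isPath_of_length_eq_dist
      rw [SimpleGraph.Walk.length_concat, hql, hd]
    have := (hT.existsUnique_path o x).unique hp hc
    rw [this, SimpleGraph.Walk.penultimate_concat]

/-- The parents in a tree. -/
lemma nonempty_parents_of_isTree (t : RootedGraph.{u}) (ht : t.graph.IsTree) :
    Nonempty t.Parents := by
  classical
  choose! p hp hu using existsUnique_adj_dist_of_isTree ht t.root
  refine ⟨⟨fun x => if x = t.root then t.root else p x, t.graph.dist t.root, by simp, by simp,
    ?_, ?_⟩⟩
  · intro x hx
    simp only [if_neg hx]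
    exact (hp x hx).2
  · intro x y
    constructor
    · intro hxy
      refine ⟨hxy.ne, ?_⟩
      rcases ht.dist_eq_dist_add_one_of_adj t.root hxy with h | h
      · left
        have hx : x ≠ t.root := by rintro rfl; simp at h
        rw [if_neg hx]
        exact (hu x hx y ⟨hxy.symm, h⟩).symm
      · right
        have hy : y ≠ t.root := by rintro rfl; simp at h
        rw [if_neg hy]
        exact (hu y hy x ⟨hxy, h⟩).symm
    · rintro ⟨hne, h | h⟩
      · split_ifs at h with hx
        · exact absurd (hx.trans h) hne
        · rw [← h]
          exact (hp x hx).1.symm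
      · split_ifs at h with hy
        · exact absurd (hy.trans h).symm hne
        · rw [← h]
          exact (hp y hy).1

end RootedGraph

/-! ### Parents and generations in spine trees -/

/-- The parent of an individual of a spine tree. -/
def spinePar (p : ℕ × List ℕ) : ℕ × List ℕ :=
  -- Truncated subtraction makes the root `(0, [])` its own parent.
  if p.2 = [] then (p.1 - 1, []) else (p.1, p.2.dropLast)

lemma spinePar_nil (i : ℕ) : spinePar (i, []) = (i - 1, []) := by simp [spinePar]

lemma spinePar_concat (i : ℕ) (w : List ℕ) (k : ℕ) : spinePar (i, w ++ [k]) = (i, w) := by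
  simp [spinePar]

lemma iterate_spinePar_nil (i k : ℕ) : spinePar^[k] (i, []) = (i - k, []) := by
  induction k with
  | zero => rfl
  | succ k ih => rw [Function.iterate_succ_apply', ih, spinePar_nil, Nat.sub_sub]

/-- The generation of an individual of a spine tree. -/
def spineHt (p : ℕ × List ℕ) : ℕ := p.1 + p.2.length

lemma spineHt_eq {p : ℕ × List ℕ} (hp : p ≠ (0, [])) : spineHt p = spineHt (spinePar p) + 1 := by
  obtain ⟨i, w⟩ := p
  rcases List.eq_nil_or_concat w with rfl | ⟨l, k, rfl⟩
  · have : i ≠ 0 := by rintro rfl; exact hp rfl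
    simp only [spinePar_nil, spineHt, List.length_nil]
    omega
  · simp only [List.concat_eq_append, spinePar_concat, spineHt, List.length_append,
      List.length_singleton]
    omega

lemma isChild_iff (p q : ℕ × List ℕ) : IsChild p q ↔ q ≠ (0, []) ∧ spinePar q = p := by
  obtain ⟨i, w⟩ := p
  obtain ⟨j, x⟩ := q
  unfold IsChild
  rcases List.eq_nil_or_concat x with rfl | ⟨l, k, rfl⟩
  · simp only [spinePar_nil, Prod.mk.injEq, ne_eq, and_true]
    constructor
    · rintro (⟨-, k, hk⟩ | ⟨rfl, rfl⟩)
      · simp at hk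
      · simp
    · rintro ⟨h1, h2, rfl⟩
      right
      exact ⟨by omega, rfl⟩
  · simp only [List.concat_eq_append, spinePar_concat]
    constructor
    · rintro (⟨rfl, k', hk⟩ | ⟨-, -, hk⟩)
      · obtain ⟨rfl, -⟩ := List.append_inj' hk rfl
        simp
      · simp at hk
    · rintro ⟨-, h⟩
      obtain ⟨rfl, rfl⟩ := Prod.mk.inj h
      exact Or.inl ⟨rfl, k, rfl⟩

lemma nil_mem_familyTree (ξ : List ℕ → ℕ) : [] ∈ familyTree ξ := by
  simp [familyTree]

lemma concat_mem_familyTree {ξ : List ℕ → ℕ} {w : List ℕ} {k : ℕ} :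
    w ++ [k] ∈ familyTree ξ ↔ w ∈ familyTree ξ ∧ k < ξ w := by
  constructor
  · intro h
    exact ⟨fun x j hx => h x j (hx.trans (List.prefix_append _ _)), h w k (List.prefix_refl _)⟩
  · rintro ⟨hw, hk⟩ x j hx
    rcases List.prefix_concat_iff.1 hx with h | h
    · obtain ⟨rfl, hj⟩ := List.append_inj' h rfl
      obtain rfl : j = k := by simpa using hj
      exact hk
    · exact hw x j h

lemma spinePar_mem {ξ : ℕ → List ℕ → ℕ} {K : ℕ∞} {p : ℕ × List ℕ} (hp : p ∈ spineVertices ξ K) :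
    spinePar p ∈ spineVertices ξ K := by
  obtain ⟨i, w⟩ := p
  rcases List.eq_nil_or_concat w with rfl | ⟨l, k, rfl⟩
  · rw [spinePar_nil]
    exact ⟨le_trans (by exact_mod_cast Nat.sub_le _ _) hp.1, nil_mem_familyTree _⟩
  · rw [List.concat_eq_append] at hp ⊢
    rw [spinePar_concat]
    exact ⟨hp.1, (concat_mem_familyTree.1 hp.2).1⟩

/-- The parents in a spine tree. -/
def spineTreeParents (ξ : ℕ → List ℕ → ℕ) (K : ℕ∞) : (spineTree ξ K).Parents where
  par x := ⟨spinePar x.1, spinePar_mem x.2⟩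
  ht x := spineHt x.1
  par_root := Subtype.ext (spinePar_nil 0)
  ht_root := rfl
  ht_eq x hx := spineHt_eq fun h => hx (Subtype.ext h)
  adj_iff x y := by
    have e : ∀ a b : (spineTree ξ K).V, a = b ↔ a.1 = b.1 := fun _ _ => Subtype.ext_iff
    have h : (spineTree ξ K).graph.Adj x y ↔
        x.1 ≠ y.1 ∧ (spinePar x.1 = y.1 ∨ spinePar y.1 = x.1) := by
      change (SimpleGraph.fromRel IsChild).Adj x.1 y.1 ↔ _
      rw [SimpleGraph.fromRel_adj, isChild_iff, isChild_iff]
      constructor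
      · rintro ⟨h, h' | h'⟩
        · exact ⟨h, Or.inr h'.2⟩
        · exact ⟨h, Or.inl h'.2⟩
      · rintro ⟨h, h' | h'⟩
        · refine ⟨h, Or.inr ⟨fun h0 => h ?_, h'⟩⟩
          rw [← h', h0, spinePar_nil]
        · refine ⟨h, Or.inl ⟨fun h0 => h ?_, h'⟩⟩
          rw [← h', h0, spinePar_nil]
    exact h.trans (and_congr (not_congr (e x y))
      (or_congr (e ⟨_, spinePar_mem x.2⟩ y) (e ⟨_, spinePar_mem y.2⟩ x))).symm

/-- The individuals of generation at most `h` of a spine tree. -/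
def spineBall (ξ : ℕ → List ℕ → ℕ) (K : ℕ∞) (h : ℕ) : Set (ℕ × List ℕ) :=
  {p | p ∈ spineVertices ξ K ∧ spineHt p ≤ h}

lemma mem_ball_spineTree {ξ : ℕ → List ℕ → ℕ} {K : ℕ∞} {h : ℕ} (x : (spineTree ξ K).V) :
    x ∈ (spineTree ξ K).ball h ↔ spineHt x.1 ≤ h := by
  simp only [RootedGraph.ball, Set.mem_ofPred_eq, (spineTreeParents ξ K).height_eq]
  exact Nat.cast_le

/-! ### Isomorphisms as maps into the individuals -/

namespace RootedGraph.Parents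

variable {t : RootedGraph.{u}} (P : t.Parents)

/-- The maps to the individuals of spine trees that identify a rooted tree with the rooted tree
formed by the individuals in `W`. -/
def embeddings (W : Set (ℕ × List ℕ)) : Set (t.V → ℕ × List ℕ) :=
  {f | f t.root = (0, []) ∧ (∀ x, f (P.par x) = spinePar (f x)) ∧ Set.BijOn f Set.univ W}

/-- Forgetting the subtypes places the isomorphisms for all `ξ` and `K` in the single type `t.V → ℕ
× List ℕ`, where they can be compared with labels. -/
lemma natCard_iso_trunc (ξ : ℕ → List ℕ → ℕ) (K : ℕ∞) (h : ℕ) :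
    Nat.card (t.Iso ((spineTree ξ K).trunc h)) =
      Nat.card (P.embeddings (spineBall ξ K h)) := by
  let Q := (spineTreeParents ξ K).trunc h
  let Φ : t.Iso ((spineTree ξ K).trunc h) → t.V → ℕ × List ℕ := fun φ x => (φ.1 x).1.1
  have hΦ : Function.Injective Φ := by
    intro φ ψ hφ
    apply Subtype.ext
    apply RelIso.ext
    intro x
    exact Subtype.ext (Subtype.ext (congrFun hφ x))
  have hrange : Set.range Φ = P.embeddings (spineBall ξ K h) := by
    ext f
    constructor
    · rintro ⟨φ, rfl⟩
      refine ⟨?_, fun x => ?_, fun x _ => ?_, fun x _ y _ hxy => ?_, fun p hp => ?_⟩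
      · change (φ.1 t.root).1.1 = _
        obtain ⟨φ, hφ⟩ := φ
        change (φ t.root).1.1 = _
        rw [hφ]
        rfl
      · exact congrArg (fun z => z.1.1) (P.iso_par Q φ x)
      · exact ⟨(φ.1 x).1.2, (mem_ball_spineTree _).1 (φ.1 x).2⟩
      · exact φ.1.injective (Subtype.ext (Subtype.ext hxy))
      · obtain ⟨x, hx⟩ := φ.1.surjective ⟨⟨p, hp.1⟩, (mem_ball_spineTree _).2 hp.2⟩
        exact ⟨x, trivial, congrArg (fun z => z.1.1) hx⟩
    · rintro ⟨hr, hp, hb⟩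
      refine ⟨P.iso Q (fun x => ⟨⟨f x, (hb.mapsTo trivial).1⟩,
        (mem_ball_spineTree _).2 (hb.mapsTo (Set.mem_univ x)).2⟩) ⟨fun x y hxy => ?_, fun y => ?_⟩
        ?_ fun x => ?_, rfl⟩
      · exact hb.injOn trivial trivial (congrArg (fun z => z.1.1) hxy)
      · obtain ⟨x, -, hx⟩ := hb.surjOn ⟨y.1.2, (mem_ball_spineTree _).1 y.2⟩
        exact ⟨x, Subtype.ext (Subtype.ext hx)⟩
      · exact Subtype.ext (Subtype.ext hr)
      · exact Subtype.ext (Subtype.ext (hp x))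
  rw [← hrange]
  exact (Nat.card_range_of_injective hΦ).symm

end RootedGraph.Parents

namespace RootedGraph

/-- Isomorphisms from a given rooted graph are as many as its automorphisms. -/
lemma natCard_iso_of_sameShape {G : RootedGraph.{u}} {H : RootedGraph.{v}} (h : H.SameShape G) :
    Nat.card (G.Iso H) = Nat.card G.Aut := by
  obtain ⟨⟨e, he⟩⟩ := h
  have he' : e.symm G.root = H.root := by rw [← he]; exact e.symm_apply_apply _
  refine Nat.card_congr ⟨fun φ => ⟨φ.1.trans e, ?_⟩, fun φ => ⟨φ.1.trans e.symm, ?_⟩, ?_, ?_⟩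
  · obtain ⟨φ, hφ⟩ := φ
    change e (φ G.root) = _
    rw [hφ, he]
  · obtain ⟨φ, hφ⟩ := φ
    change e.symm (φ G.root) = _
    rw [hφ, he']
  · intro φ
    apply Subtype.ext
    apply RelIso.ext
    intro x
    exact e.symm_apply_apply _
  · intro φ
    apply Subtype.ext
    apply RelIso.ext
    intro x
    exact e.apply_symm_apply _

lemma isEmpty_iso_of_not_sameShape {G : RootedGraph.{u}} {H : RootedGraph.{v}}
    (h : ¬ H.SameShape G) : IsEmpty (G.Iso H) := by
  refine ⟨fun φ => h ⟨⟨φ.1.symm, ?_⟩⟩⟩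
  obtain ⟨φ, hφ⟩ := φ
  change φ.symm H.root = G.root
  rw [← hφ]
  exact φ.symm_apply_apply _

lemma Aut.finite (G : RootedGraph.{u}) [Finite G.V] : Finite G.Aut :=
  Finite.of_injective (fun φ : G.Aut => (φ.1 : G.V → G.V)) fun _ _ h =>
    Subtype.ext (RelIso.ext fun x => congrFun h x)

lemma Aut.card_pos (G : RootedGraph.{u}) [Finite G.V] : 0 < Nat.card G.Aut := by
  have := Aut.finite G
  have : Nonempty G.Aut := ⟨⟨SimpleGraph.Iso.refl, rfl⟩⟩
  exact Nat.card_pos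

end RootedGraph

/-! ### Paths to the root and labellings -/

namespace RootedGraph.Parents

variable {t : RootedGraph.{u}} (P : t.Parents)

/-- The vertices on the path from the root to `v`. -/
def anc (v : t.V) : Set t.V := {x | ∃ k, P.par^[k] v = x}

lemma ht_iterate (v : t.V) (k : ℕ) : P.ht (P.par^[k] v) = P.ht v - k := by
  induction k with
  | zero => rfl
  | succ k ih => rw [Function.iterate_succ_apply', P.ht_par, ih, Nat.sub_sub]

lemma iterate_ht (v : t.V) : P.par^[P.ht v] v = t.root := by
  rw [← P.ht_eq_zero_iff, P.ht_iterate, Nat.sub_self]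

lemma self_mem_anc (v : t.V) : v ∈ P.anc v := ⟨0, rfl⟩

lemma root_mem_anc (v : t.V) : t.root ∈ P.anc v := ⟨_, P.iterate_ht v⟩

lemma par_mem_anc {v x : t.V} (hx : x ∈ P.anc v) : P.par x ∈ P.anc v := by
  obtain ⟨k, rfl⟩ := hx
  exact ⟨k + 1, Function.iterate_succ_apply' _ _ _⟩

lemma ht_le_of_mem_anc {v x : t.V} (hx : x ∈ P.anc v) : P.ht x ≤ P.ht v := by
  obtain ⟨k, rfl⟩ := hx
  rw [P.ht_iterate]
  exact Nat.sub_le _ _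

lemma iterate_of_mem_anc {v x : t.V} (hx : x ∈ P.anc v) : P.par^[P.ht v - P.ht x] v = x := by
  obtain ⟨k, rfl⟩ := hx
  rw [P.ht_iterate]
  rcases le_total k (P.ht v) with h | h
  · rw [Nat.sub_sub_self h]
  · have : P.par^[k] v = t.root := by
      rw [← P.ht_eq_zero_iff, P.ht_iterate, Nat.sub_eq_zero_of_le h]
    rw [this, Nat.sub_eq_zero_of_le h, Nat.sub_zero, P.iterate_ht]

lemma eq_of_mem_anc {v x y : t.V} (hx : x ∈ P.anc v) (hy : y ∈ P.anc v) (h : P.ht x = P.ht y) :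
    x = y := by
  rw [← P.iterate_of_mem_anc hx, ← P.iterate_of_mem_anc hy, h]

lemma anc_injective : Function.Injective P.anc := by
  intro v w h
  have h1 : v ∈ P.anc w := h ▸ P.self_mem_anc v
  have h2 : w ∈ P.anc v := h ▸ P.self_mem_anc w
  exact P.eq_of_mem_anc h1 (P.self_mem_anc w)
    (le_antisymm (P.ht_le_of_mem_anc h1) (P.ht_le_of_mem_anc h2))

lemma ncard_anc (v : t.V) : (P.anc v).ncard = P.ht v + 1 := by
  have h : P.ht '' P.anc v = Set.Iic (P.ht v) := by
    ext k
    constructor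
    · rintro ⟨x, hx, rfl⟩
      exact P.ht_le_of_mem_anc hx
    · intro hk
      refine ⟨_, ⟨P.ht v - k, rfl⟩, ?_⟩
      rw [P.ht_iterate, Nat.sub_sub_self hk]
  rw [← Set.InjOn.ncard_image (f := P.ht) fun x hx y hy => P.eq_of_mem_anc hx hy, h,
    Set.ncard_eq_toFinset_card', Set.toFinset_Iic, Nat.card_Iic]

/-- The children of `x` that are not on the path from the root to `v`. -/
abbrev Child (v x : t.V) : Type u := {y : t.V // P.par y = x ∧ y ∉ P.anc v}

/-- An enumeration, for every vertex, of its children off the path from the root to `v`. -/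
abbrev Ranks (v : t.V) : Type u := ∀ x, P.Child v x ≃ Fin (Nat.card (P.Child v x))

variable {P}

open Classical in
/-- The vertex `x` of generation `n` as an individual of a spine tree, when the path to `v` is the
spine and `r` gives the ranks of the other vertices among their siblings. -/
noncomputable def labelAux {v : t.V} (r : P.Ranks v) : ℕ → t.V → ℕ × List ℕ
  -- The vertex may be ignored, since only the root has generation `0`.
  | 0, _ => (0, [])
  | n + 1, x =>
    if hx : x ∈ P.anc v then (n + 1, [])
    else ((labelAux r n (P.par x)).1,
      (labelAux r n (P.par x)).2 ++ [(r (P.par x) ⟨x, rfl, hx⟩ : ℕ)])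

/-- The vertices as individuals of a spine tree, when the path to `v` is the spine and `r` gives
the ranks of the other vertices among their siblings. -/
noncomputable def label {v : t.V} (r : P.Ranks v) (x : t.V) : ℕ × List ℕ :=
  labelAux r (P.ht x) x

section label

variable {v : t.V} (r : P.Ranks v)

lemma label_of_mem {x : t.V} (hx : x ∈ P.anc v) : label r x = (P.ht x, []) := by
  unfold label
  generalize P.ht x = n
  cases n with
  | zero => rfl
  | succ n => rw [labelAux, dif_pos hx]

lemma label_of_notMem {x : t.V} (hx : x ∉ P.anc v) :
    label r x = ((label r (P.par x)).1,
      (label r (P.par x)).2 ++ [(r (P.par x) ⟨x, rfl, hx⟩ : ℕ)]) := by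
  have h0 : x ≠ t.root := fun h => hx (h ▸ P.root_mem_anc v)
  rw [label, P.ht_eq x h0, labelAux, dif_neg hx]
  rfl

lemma label_child (x : t.V) (y : P.Child v x) :
    label r y = ((label r x).1, (label r x).2 ++ [(r x y : ℕ)]) := by
  obtain ⟨y, rfl, hy⟩ := y
  exact label_of_notMem r hy

lemma label_root : label r t.root = (0, []) := by
  rw [label_of_mem r (P.root_mem_anc v), P.ht_root]

lemma spinePar_label (x : t.V) : spinePar (label r x) = label r (P.par x) := by
  by_cases hx : x ∈ P.anc v
  · rw [label_of_mem r hx, label_of_mem r (P.par_mem_anc hx), spinePar_nil, P.ht_par]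
  · rw [label_of_notMem r hx, spinePar_concat]

lemma spineHt_label (x : t.V) : spineHt (label r x) = P.ht x := by
  refine P.induction (motive := fun x => spineHt (label r x) = P.ht x) ?_ (fun x hx ih => ?_) x
  · rw [label_root, P.ht_root]
    rfl
  · by_cases hxv : x ∈ P.anc v
    · rw [label_of_mem r hxv]
      rfl
    · rw [P.ht_eq x hx, ← ih, label_of_notMem r hxv]
      simp only [spineHt, List.length_append, List.length_singleton]
      omega

lemma label_snd_eq_nil {x : t.V} : (label r x).2 = [] ↔ x ∈ P.anc v := by
  constructor
  · intro h
    by_contra hx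
    rw [label_of_notMem r hx] at h
    simp at h
  · intro hx
    rw [label_of_mem r hx]

/-- Equal labels have the same generation and are both on or both off the spine. On the spine the
generation decides; off it, the parents agree by induction and then the rank decides. -/
lemma label_injective : Function.Injective (label r) := by
  intro x
  refine P.induction (motive := fun x => ∀ ⦃y⦄, label r x = label r y → x = y) ?_
    (fun x hx ih => ?_) x
  · intro y hy
    have := spineHt_label r y
    rw [← hy, spineHt_label, P.ht_root] at this
    exact (P.ht_eq_zero_iff.1 this.symm).symm
  · intro y hy
    have hht : P.ht x = P.ht y := by rw [← spineHt_label r, hy, spineHt_label]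
    by_cases hxv : x ∈ P.anc v
    · refine P.eq_of_mem_anc hxv ?_ hht
      rw [← label_snd_eq_nil r, ← hy, label_snd_eq_nil]
      exact hxv
    · have hyv : y ∉ P.anc v := by
        rw [← label_snd_eq_nil r, ← hy, label_snd_eq_nil]
        exact hxv
      have hpar : P.par y = P.par x := by
        refine (ih ?_).symm
        rw [← spinePar_label, hy, spinePar_label]
      have h1 := label_child r (P.par x) ⟨x, rfl, hxv⟩
      have h2 := label_child r (P.par x) ⟨y, hpar, hyv⟩
      rw [← hy, h1] at h2
      have h3 : ((r (P.par x) ⟨x, rfl, hxv⟩ : ℕ)) = (r (P.par x) ⟨y, hpar, hyv⟩ : ℕ) := by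
        simpa using h2
      exact congrArg Subtype.val ((r (P.par x)).injective (Fin.ext h3))

end label

/-- The label function determines the end of the spine and the ranks. -/
lemma sigma_label_injective :
    Function.Injective fun s : (Σ v, P.Ranks v) => label s.2 := by
  rintro ⟨v, r⟩ ⟨w, s⟩ h
  have h : label r = label s := h
  obtain rfl : v = w := by
    apply P.anc_injective
    ext x
    rw [← label_snd_eq_nil r, h, label_snd_eq_nil]
  congr 1
  funext x
  ext y
  have h1 := label_child r x y
  have h2 := label_child s x y
  rw [← h, h1] at h2
  simpa using h2

/-! ### Labellings that are isomorphisms -/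

variable (P) in
/-- The event that the spine tree truncated at height `h` has the vertices prescribed by `r`. -/
def labelEvent (h : ℕ) (s : Σ v, P.Ranks v) : Set ((ℕ → List ℕ → ℕ) × ℕ∞) :=
  -- Offspring of generation `h` lie outside the ball, so only generations below `h` are
  -- constrained. Likewise, if `v` has height `h`, any `K ≥ h` is allowed.
  {ξ : ℕ → List ℕ → ℕ | ∀ x, P.ht x < h →
    ξ (label s.2 x).1 (label s.2 x).2 = Nat.card (P.Child s.1 x)} ×ˢ
  {K : ℕ∞ | min K h = (P.ht s.1 : ℕ∞)}

lemma label_mem_embeddings {h : ℕ} (hh : ∀ x, P.ht x ≤ h) {s : Σ v, P.Ranks v}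
    {ξ : ℕ → List ℕ → ℕ} {K : ℕ∞} (hω : (ξ, K) ∈ P.labelEvent h s) :
    label s.2 ∈ P.embeddings (spineBall ξ K h) := by
  obtain ⟨v, r⟩ := s
  obtain ⟨hξ, hK⟩ := hω
  simp only [Set.mem_ofPred_eq] at hξ hK
  refine ⟨label_root r, fun x => (spinePar_label r x).symm, fun x _ => ⟨?_, ?_⟩,
    (label_injective r).injOn, ?_⟩
  · refine P.induction (motive := fun x => label r x ∈ spineVertices ξ K) ?_
      (fun x hx ih => ?_) x
    · rw [label_root]
      exact ⟨zero_le, nil_mem_familyTree _⟩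
    · by_cases hxv : x ∈ P.anc v
      · rw [label_of_mem r hxv]
        refine ⟨?_, nil_mem_familyTree _⟩
        have : ((P.ht x : ℕ) : ℕ∞) ≤ P.ht v := by exact_mod_cast P.ht_le_of_mem_anc hxv
        rw [← hK] at this
        exact this.trans (min_le_left _ _)
      · rw [label_of_notMem r hxv]
        refine ⟨ih.1, concat_mem_familyTree.2 ⟨ih.2, ?_⟩⟩
        have := hh x
        rw [hξ _ (by rw [P.ht_eq x hx] at this; omega)]
        exact Fin.is_lt _
  · rw [spineHt_label]
    exact hh x
  -- Surjectivity by induction on the word: the parent of a nonempty word in the ball has generation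
  -- less than `h`, so its offspring number is prescribed.
  · rintro ⟨i, w⟩ ⟨⟨hi, hw⟩, hht⟩
    induction w using List.reverseRecOn with
    | nil =>
      have hi' : i ≤ P.ht v := by
        have : (i : ℕ∞) ≤ min K h := le_min hi (by simpa [spineHt] using hht)
        rw [hK] at this
        exact_mod_cast this
      refine ⟨P.par^[P.ht v - i] v, trivial, ?_⟩
      rw [label_of_mem r ⟨_, rfl⟩, P.ht_iterate, Nat.sub_sub_self hi']
    | append_singleton w k ih =>
      obtain ⟨hw1, hk⟩ := concat_mem_familyTree.1 hw
      simp only [spineHt, List.length_append, List.length_singleton] at hht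
      obtain ⟨x, -, hx⟩ := ih (by simp only [spineHt]; omega) hi hw1
      have hxh : P.ht x < h := by
        rw [← spineHt_label r, hx]
        simp only [spineHt]
        omega
      have hc := hξ x hxh
      rw [hx] at hc
      simp only at hc hk
      rw [hc] at hk
      refine ⟨(r x).symm ⟨k, hk⟩, trivial, ?_⟩
      rw [label_child, hx, Equiv.apply_symm_apply]

lemma exists_equiv_of_range_eq {α : Type*} (g : α → ℕ) (hg : Function.Injective g) (n : ℕ)
    (hn : Set.range g = Set.Iio n) :
    Nat.card α = n ∧ ∃ e : α ≃ Fin (Nat.card α), ∀ a, (e a : ℕ) = g a := by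
  have hlt : ∀ a, g a < n := fun a => by
    have : g a ∈ Set.range g := ⟨a, rfl⟩
    rwa [hn] at this
  let e : α ≃ Fin n := Equiv.ofBijective (fun a => ⟨g a, hlt a⟩)
    ⟨fun a b h => hg (by simpa using h), fun k => by
      have : (k : ℕ) ∈ Set.range g := by rw [hn]; exact k.2
      obtain ⟨a, ha⟩ := this
      exact ⟨a, Fin.ext ha⟩⟩
  have hc : Nat.card α = n := by rw [Nat.card_congr e, Nat.card_fin]
  exact ⟨hc, e.trans (finCongr hc.symm), fun a => rfl⟩

lemma spineHt_embedding {W : Set (ℕ × List ℕ)} {f : t.V → ℕ × List ℕ}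
    (hf : f ∈ P.embeddings W) (x : t.V) : spineHt (f x) = P.ht x := by
  obtain ⟨h0, hp, hb⟩ := hf
  refine P.induction (motive := fun x => spineHt (f x) = P.ht x) ?_ (fun x hx ih => ?_) x
  · rw [h0, P.ht_root]
    rfl
  · rw [P.ht_eq x hx, ← ih, hp, spineHt_eq]
    intro h
    exact hx (hb.injOn trivial trivial (h.trans h0.symm))

/-- The pair is recovered from `f`: `v` is the preimage of the last spine vertex in the ball, and
the rank of a vertex off the spine is the last letter of its word. -/
lemma exists_label_of_mem_embeddings {h : ℕ} {ξ : ℕ → List ℕ → ℕ} {K : ℕ∞}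
    {f : t.V → ℕ × List ℕ} (hf : f ∈ P.embeddings (spineBall ξ K h)) :
    ∃ s : Σ v, P.Ranks v, (ξ, K) ∈ P.labelEvent h s ∧ label s.2 = f := by
  have hht := spineHt_embedding hf
  obtain ⟨h0, hp, hb⟩ := hf
  have hinj : Function.Injective f := fun x y => hb.injOn trivial trivial
  have hle : ∀ x, P.ht x ≤ h := fun x => by
    rw [← hht]
    exact (hb.mapsTo (Set.mem_univ x)).2
  obtain ⟨m, hm⟩ : ∃ m : ℕ, min K h = (m : ℕ∞) :=
    ⟨(min K h).toNat, (ENat.natCast_toNat (ne_top_of_le_ne_top (ENat.natCast_ne_top h)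
      (min_le_right _ _))).symm⟩
  have hmK : (m : ℕ∞) ≤ K := hm ▸ min_le_left _ _
  have hmh : m ≤ h := by
    have : (m : ℕ∞) ≤ h := hm ▸ min_le_right _ _
    exact_mod_cast this
  obtain ⟨v, -, hv⟩ : (m, []) ∈ f '' Set.univ :=
    hb.surjOn ⟨⟨hmK, nil_mem_familyTree _⟩, by simpa [spineHt] using hmh⟩
  have hiter : ∀ k x, f (P.par^[k] x) = spinePar^[k] (f x) := by
    intro k x
    induction k with
    | zero => rfl
    | succ k ih => rw [Function.iterate_succ_apply', hp, ih, Function.iterate_succ_apply']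
  have hvm : P.ht v = m := by
    rw [← hht, hv]
    rfl
  have hanc : ∀ x, x ∈ P.anc v ↔ (f x).2 = [] := by
    intro x
    constructor
    · rintro ⟨k, rfl⟩
      rw [hiter, hv, iterate_spinePar_nil]
    · intro hx
      have hfx : f x = ((f x).1, []) := Prod.ext rfl hx
      have hmem := hb.mapsTo (Set.mem_univ x)
      have h1 : (f x).1 ≤ m := by
        have h2 := hmem.2
        rw [hfx] at h2
        have : ((f x).1 : ℕ∞) ≤ min K h := le_min hmem.1.1 (by simpa [spineHt] using h2)
        rw [hm] at this
        exact_mod_cast this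
      refine ⟨m - (f x).1, hinj ?_⟩
      rw [hiter, hv, iterate_spinePar_nil, hfx, Nat.sub_sub_self h1]
  -- The default `0` is never used: words off the spine are nonempty.
  have hchild : ∀ x (y : P.Child v x), f y = ((f x).1, (f x).2 ++ [(f y).2.getLastD 0]) := by
    rintro x ⟨y, rfl, hy⟩
    rw [hanc] at hy
    rw [hp]
    generalize hw : f y = q at hy
    obtain ⟨i, w⟩ := q
    rcases List.eq_nil_or_concat w with rfl | ⟨l, k, rfl⟩
    · exact absurd rfl hy
    · simp [spinePar]
  have hex : ∀ x, (P.ht x < h → Nat.card (P.Child v x) = ξ (f x).1 (f x).2) ∧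
      ∃ e : P.Child v x ≃ Fin (Nat.card (P.Child v x)), ∀ y, (e y : ℕ) = (f y).2.getLastD 0 := by
    intro x
    by_cases hx : P.ht x < h
    · have := exists_equiv_of_range_eq (fun y : P.Child v x => (f y).2.getLastD 0) ?_
        (ξ (f x).1 (f x).2) ?_
      · exact ⟨fun _ => this.1, this.2⟩
      · intro y z hyz
        apply Subtype.ext
        apply hinj
        rw [hchild x y, hchild x z]
        simp only at hyz
        rw [hyz]
      · ext k
        have hfx := (hb.mapsTo (Set.mem_univ x)).1
        constructor
        · rintro ⟨y, rfl⟩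
          have := (hb.mapsTo (Set.mem_univ y.1)).1
          rw [hchild x y] at this
          exact (concat_mem_familyTree.1 this.2).2
        · intro hk
          obtain ⟨y, -, hy⟩ : ((f x).1, (f x).2 ++ [k]) ∈ f '' Set.univ := by
            refine hb.surjOn ⟨⟨hfx.1, concat_mem_familyTree.2 ⟨hfx.2, hk⟩⟩, ?_⟩
            rw [← hht] at hx
            simp only [spineHt, List.length_append, List.length_singleton] at hx ⊢
            omega
          refine ⟨⟨y, hinj ?_, fun hyv => ?_⟩, ?_⟩
          · rw [hp, hy, spinePar_concat]
          · rw [hanc, hy] at hyv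
            simp at hyv
          · simp [hy]
    -- At generation `h` there are no children in `t`, so the empty enumeration serves.
    · refine ⟨fun h => absurd h hx, ?_⟩
      have : IsEmpty (P.Child v x) := by
        refine ⟨fun ⟨y, hy, hyv⟩ => hx ?_⟩
        have hy0 : y ≠ t.root := fun h => hyv (h ▸ P.root_mem_anc v)
        have h1 := P.ht_eq y hy0
        have h2 := hle y
        rw [hy] at h1
        omega
      exact ⟨Finite.equivFin _, fun y => isEmptyElim y⟩
  choose hcard r hr using hex
  have hlabel : label r = f := by
    funext x
    refine P.induction (motive := fun x => label r x = f x) ?_ (fun x hx ih => ?_) x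
    · rw [label_root, h0]
    · by_cases hxv : x ∈ P.anc v
      · have h2 := hht x
        rw [label_of_mem r hxv, ← h2]
        rw [hanc] at hxv
        exact Prod.ext (by simp [spineHt, hxv]) hxv.symm
      · rw [label_of_notMem r hxv, ih, hchild (P.par x) ⟨x, rfl, hxv⟩, hr]
  refine ⟨⟨v, r⟩, ⟨fun x hx => ?_, ?_⟩, hlabel⟩
  · simp only [hlabel]
    exact (hcard x hx).symm
  · simp only [Set.mem_ofPred_eq, hvm]
    exact hm

/-- The isomorphisms to a truncated spine tree correspond to the events that occur. -/
lemma natCard_iso_eq {h : ℕ} (hh : ∀ x, P.ht x ≤ h) (ω : (ℕ → List ℕ → ℕ) × ℕ∞) :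
    Nat.card (t.Iso ((spineTree ω.1 ω.2).trunc h)) =
      Nat.card {s : Σ v, P.Ranks v // ω ∈ P.labelEvent h s} := by
  rw [P.natCard_iso_trunc]
  symm
  refine Nat.card_congr (Equiv.ofBijective
    (fun s => ⟨label s.1.2, label_mem_embeddings hh s.2⟩) ⟨fun s s' hs => ?_, fun f => ?_⟩)
  · exact Subtype.ext (sigma_label_injective (congrArg Subtype.val hs))
  · obtain ⟨s, hs, hsf⟩ := exists_label_of_mem_embeddings f.2
    exact ⟨⟨s, hs⟩, Subtype.ext hsf⟩

end RootedGraph.Parents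

/-! ### Laws of the offspring numbers and of the spine -/

lemma measurableSet_forall_mem_eq {ι : Type*} (S : Finset ι) (F : ι → ℕ × List ℕ) (c : ι → ℕ) :
    MeasurableSet {ξ : ℕ → List ℕ → ℕ | ∀ x ∈ S, ξ (F x).1 (F x).2 = c x} := by
  have : {ξ : ℕ → List ℕ → ℕ | ∀ x ∈ S, ξ (F x).1 (F x).2 = c x} =
      ⋂ x ∈ S, (fun ξ : ℕ → List ℕ → ℕ => ξ (F x).1 (F x).2) ⁻¹' {c x} := by
    ext ξ
    simp
  rw [this]
  refine S.measurableSet_biInter fun x _ => ?_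
  exact measurableSet_preimage (by fun_prop) (measurableSet_singleton _)

/-- The probability that given individuals have given offspring numbers. -/
lemma infinitePi_bgwpLaw_forall_mem_eq {ι : Type*} (β : ℝ≥0) (S : Finset ι)
    (F : ι → ℕ × List ℕ) (hF : Function.Injective F) (c : ι → ℕ) :
    (Measure.infinitePi fun _ : ℕ => bgwpLaw β)
      {ξ | ∀ x ∈ S, ξ (F x).1 (F x).2 = c x} = ∏ x ∈ S, poissonMeasure β {c x} := by
  classical
  rcases S.eq_empty_or_nonempty with rfl | ⟨x₀, -⟩
  · simp
  have : Nonempty ι := ⟨x₀⟩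
  unfold bgwpLaw
  -- Uncurrying turns the iterated product into one product over pairs, where the event is a
  -- cylinder over the image of `F`.
  rw [← Measure.infinitePi_map_curry (fun (_ : ℕ) (_ : List ℕ) => poissonMeasure β),
    Measure.map_apply (by fun_prop) (measurableSet_forall_mem_eq S F c)]
  have h : (MeasurableEquiv.curry ℕ (List ℕ) ℕ) ⁻¹'
      {ξ | ∀ x ∈ S, ξ (F x).1 (F x).2 = c x} =
      Set.pi (S.image F : Finset _) fun p => {c (Function.invFun F p)} := by
    ext η
    simp only [Set.mem_preimage, Set.mem_ofPred_eq, Set.mem_pi, Finset.coe_image,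
      Set.forall_mem_image, Function.leftInverse_invFun hF _, Set.mem_singleton_iff]
    rfl
  rw [h, Measure.infinitePi_pi _ (fun _ _ => measurableSet_singleton _),
    Finset.prod_image hF.injOn]
  simp only [Function.leftInverse_invFun hF _]

lemma spineParam_ne_zero {α : ℝ≥0} (hα : α ≠ 0) : spineParam α ≠ 0 := by
  intro h
  have h1 : (α : ℝ) / (1 + α) = 0 := congrArg Subtype.val h
  have h2 : (0 : ℝ) < α := by positivity
  have h3 : (0 : ℝ) < α / (1 + α) := by positivity
  exact h3.ne' h1

lemma one_sub_spineParam (α : ℝ≥0) : (1 : ℝ) - spineParam α = 1 / (1 + α) := by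
  have h : (spineParam α : ℝ) = (α : ℝ) / (1 + α) := rfl
  have h2 : (1 : ℝ) + α ≠ 0 := by positivity
  rw [h]
  field_simp
  ring

lemma geometricMeasure_Ici {p : unitInterval} (hp : p ≠ 0) (h : ℕ) :
    (geometricMeasure p).real (Set.Ici h) = (1 - (p : ℝ)) ^ h := by
  induction h with
  | zero =>
    have : Set.Ici (0 : ℕ) = Set.univ := by ext; simp
    rw [this, probReal_univ, pow_zero]
  | succ h ih =>
    have hs : Set.Ici h = {h} ∪ Set.Ici (h + 1) := by
      ext k
      simp only [Set.mem_Ici, Set.mem_union, Set.mem_singleton_iff]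
      omega
    rw [hs, measureReal_union (by simp) (MeasurableSet.of_discrete),
      geometricMeasure_real_singleton hp] at ih
    rw [pow_succ]
    linarith

/-- The law of the height at which the spine leaves the ball of radius `h`. -/
lemma spineLaw_min_eq (α : ℝ≥0) {m h : ℕ} (hm : m ≤ h) :
    spineLaw α {K : ℕ∞ | min K h = (m : ℕ∞)} =
      ENNReal.ofReal ((1 / (1 + (α : ℝ))) ^ (m + 1) * (if m = h then 1 + (α : ℝ) else α)) := by
  have hα1 : (1 : ℝ) + α ≠ 0 := by positivity
  unfold spineLaw
  -- For `α > 0`, the tail mass `(1 + α)⁻ʰ` at `m = h` is written with exponent `h + 1`, whence the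
  -- factor `1 + α`. For `α = 0` all the mass is at `m = h`.
  split_ifs with hα hmh hmh
  · subst hα hmh
    rw [Measure.dirac_apply' _ (MeasurableSet.of_discrete), Set.indicator_of_mem (by simp)]
    simp
  · subst hα
    rw [Measure.dirac_apply' _ (MeasurableSet.of_discrete), Set.indicator_of_notMem]
    · simp
    · simp only [Set.mem_ofPred_eq, top_inf_eq]
      exact fun hc => hmh (by exact_mod_cast hc.symm)
  · subst hmh
    rw [Measure.map_apply (by fun_prop) (MeasurableSet.of_discrete)]
    have : (fun k : ℕ => (k : ℕ∞)) ⁻¹' {K : ℕ∞ | min K m = (m : ℕ∞)} = Set.Ici m := by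
      ext k
      simp
    rw [this, ← ofReal_measureReal, geometricMeasure_Ici (spineParam_ne_zero hα),
      one_sub_spineParam]
    congr 1
    rw [pow_succ]
    field_simp
  · rw [Measure.map_apply (by fun_prop) (MeasurableSet.of_discrete)]
    have : (fun k : ℕ => (k : ℕ∞)) ⁻¹' {K : ℕ∞ | min K h = (m : ℕ∞)} = {m} := by
      ext k
      simp only [Set.mem_preimage, Set.mem_ofPred_eq, Set.mem_singleton_iff]
      rw [← (Nat.mono_cast (α := ℕ∞)).map_min, Nat.cast_inj]
      omega
    rw [this, geometricMeasure_singleton (spineParam_ne_zero hα), one_sub_spineParam]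
    congr 1
    have h : (spineParam α : ℝ) = (α : ℝ) / (1 + α) := rfl
    rw [h, pow_succ]
    field_simp

/-! ### Expected number of isomorphisms -/

namespace RootedGraph.Parents

variable {t : RootedGraph.{u}} (P : t.Parents)

/-- Each vertex off the path to `v` is counted once, at its parent; the path itself has `P.ht v + 1`
vertices, among them the root. -/
lemma sum_natCard_child [Fintype t.V] (v : t.V) :
    ∑ x, Nat.card (P.Child v x) + (P.ht v + 1) = Nat.card t.V := by
  classical
  have e : (Σ x, P.Child v x) ≃ {y // y ∈ (P.anc v)ᶜ} :=
    ⟨fun s => ⟨s.2.1, s.2.2.2⟩, fun y => ⟨P.par y, y, rfl, y.2⟩,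
      fun ⟨x, y, hy, hyv⟩ => by subst hy; rfl, fun y => rfl⟩
  rw [← Nat.card_sigma, Nat.card_congr e, Nat.card_coe_set_eq, ← P.ncard_anc, add_comm]
  exact Set.ncard_add_ncard_compl _

lemma natCard_child_of_le {h : ℕ} (hh : ∀ x, P.ht x ≤ h) (v : t.V) {x : t.V} (hx : h ≤ P.ht x) :
    Nat.card (P.Child v x) = 0 := by
  have : IsEmpty (P.Child v x) := by
    refine ⟨fun ⟨y, hy, hyv⟩ => ?_⟩
    have hy0 : y ≠ t.root := fun h => hyv (h ▸ P.root_mem_anc v)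
    have h1 := P.ht_eq y hy0
    have h2 := hh y
    rw [hy] at h1
    omega
  exact Nat.card_of_isEmpty

lemma natCard_ranks [Fintype t.V] (v : t.V) :
    Nat.card (P.Ranks v) = ∏ x, (Nat.card (P.Child v x)).factorial := by
  classical
  rw [Nat.card_pi]
  refine Finset.prod_congr rfl fun x _ => ?_
  rw [Nat.card_congr (Equiv.equivCongr (Equiv.refl (P.Child v x))
    (Finite.equivFin (P.Child v x)).symm)]
  exact Nat.card_perm

lemma measurableSet_labelEvent [Finite t.V] (h : ℕ) (s : Σ v, P.Ranks v) :
    MeasurableSet (P.labelEvent h s) := by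
  classical
  have := Fintype.ofFinite t.V
  refine MeasurableSet.prod ?_ MeasurableSet.of_discrete
  have := measurableSet_forall_mem_eq (Finset.univ.filter fun x => P.ht x < h) (label s.2)
    fun x => Nat.card (P.Child s.1 x)
  simpa using this

/-- The Poisson weights contribute one power of `1 / (1 + α)` per vertex off the path to the end of
the spine, and the spine law one per vertex on it, hence `|t|` in all. -/
lemma spineTreeLaw_labelEvent [Fintype t.V] (α : ℝ≥0) {h : ℕ} (hh : ∀ x, P.ht x ≤ h)
    (s : Σ v, P.Ranks v) :
    spineTreeLaw α (P.labelEvent h s) = ENNReal.ofReal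
      ((∏ x, ((Nat.card (P.Child s.1 x)).factorial : ℝ))⁻¹ *
        ((1 / (1 + (α : ℝ))) ^ Nat.card t.V *
          Real.exp (-((t.below h).ncard : ℝ) / (1 + (α : ℝ))) *
            (if P.ht s.1 = h then 1 + (α : ℝ) else α))) := by
  classical
  have hset := infinitePi_bgwpLaw_forall_mem_eq (1 / (1 + α))
    (Finset.univ.filter fun x => P.ht x < h) (label s.2) (label_injective s.2)
    fun x => Nat.card (P.Child s.1 x)
  simp only [Finset.mem_filter, Finset.mem_univ, true_and] at hset
  have hbelow : (t.below h).ncard = (Finset.univ.filter fun x => P.ht x < h).card := by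
    rw [← Set.ncard_coe_finset]
    congr 1
    ext x
    simp [below, P.height_eq]
  have hprod : ∏ x with P.ht x < h, poissonMeasure (1 / (1 + α)) {Nat.card (P.Child s.1 x)} =
      ENNReal.ofReal ((∏ x, ((Nat.card (P.Child s.1 x)).factorial : ℝ))⁻¹ *
        (1 / (1 + (α : ℝ))) ^ (∑ x, Nat.card (P.Child s.1 x)) *
          Real.exp (-((t.below h).ncard : ℝ) / (1 + (α : ℝ)))) := by
    simp only [poissonMeasure_singleton]
    rw [← ENNReal.ofReal_prod_of_nonneg fun _ _ => by positivity]
    congr 1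
    -- Vertices of generation `h` have no children, so they contribute trivial factors.
    have h1 : ∀ g : ℕ → ℝ, g 0 = 1 →
        ∏ x, g (Nat.card (P.Child s.1 x)) =
          ∏ x with P.ht x < h, g (Nat.card (P.Child s.1 x)) := by
      intro g hg
      symm
      refine Finset.prod_subset (Finset.filter_subset _ _) fun x _ hx => ?_
      rw [P.natCard_child_of_le hh, hg]
      simpa using hx
    rw [← Finset.prod_pow_eq_pow_sum, h1 (fun n => (n.factorial : ℝ)) (by simp),
      h1 (fun n => (1 / (1 + (α : ℝ))) ^ n) (by simp), hbelow, Finset.prod_div_distrib,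
      Finset.prod_mul_distrib, Finset.prod_const, ← Real.exp_nat_mul]
    push_cast
    rw [div_eq_mul_inv, mul_comm _ (_)⁻¹, mul_comm (Real.exp _), ← mul_assoc]
    congr 2
    ring
  unfold spineTreeLaw labelEvent
  rw [Measure.prod_prod, hset, hprod, spineLaw_min_eq α (hh s.1),
    ← ENNReal.ofReal_mul (by positivity), ← P.sum_natCard_child s.1, pow_add]
  congr 1
  ring

/-- The expected number of isomorphisms. -/
lemma sum_spineTreeLaw_labelEvent [Fintype t.V] [Fintype (Σ v, P.Ranks v)] (α : ℝ≥0) {h : ℕ}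
    (hh : ∀ x, P.ht x ≤ h) :
    ∑ s, spineTreeLaw α (P.labelEvent h s) = ENNReal.ofReal
      ((((t.level h).ncard : ℝ) + (α : ℝ) * (Nat.card t.V : ℝ)) *
        (1 / (1 + (α : ℝ)) ^ Nat.card t.V) *
          Real.exp (-((t.below h).ncard : ℝ) / (1 + (α : ℝ)))) := by
  classical
  have hlevel : (t.level h).ncard = (Finset.univ.filter fun x => P.ht x = h).card := by
    rw [← Set.ncard_coe_finset]
    congr 1
    ext x
    simp [level, P.height_eq]
  have hfin : ∀ v, Fintype (P.Ranks v) := fun v => Fintype.ofFinite _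
  simp only [P.spineTreeLaw_labelEvent α hh]
  rw [← ENNReal.ofReal_sum_of_nonneg fun _ _ => by positivity]
  congr 1
  have huniv : (Finset.univ : Finset (Σ v, P.Ranks v)) =
      (Finset.univ : Finset t.V).sigma fun _ => Finset.univ := by
    ext s
    simp
  rw [huniv, Finset.sum_sigma]
  have hv : ∀ v : t.V, (∑ _r : P.Ranks v,
      (∏ x, ((Nat.card (P.Child v x)).factorial : ℝ))⁻¹ *
        ((1 / (1 + (α : ℝ))) ^ Nat.card t.V *
          Real.exp (-((t.below h).ncard : ℝ) / (1 + (α : ℝ))) *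
            (if P.ht v = h then 1 + (α : ℝ) else α))) =
      (1 / (1 + (α : ℝ))) ^ Nat.card t.V *
          Real.exp (-((t.below h).ncard : ℝ) / (1 + (α : ℝ))) *
            ((if P.ht v = h then 1 else 0) + (α : ℝ)) := by
    -- The number of enumerations is exactly the product of factorials in the denominator.
    intro v
    rw [Finset.sum_const, Finset.card_univ, ← Nat.card_eq_fintype_card, P.natCard_ranks,
      nsmul_eq_mul, ← mul_assoc]
    push_cast
    rw [mul_inv_cancel₀ (by positivity), one_mul]
    congr 1
    split_ifs <;> simp
  simp only [hv]
  rw [← Finset.mul_sum, Finset.sum_add_distrib, Finset.sum_const, Finset.card_univ,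
    Finset.sum_boole, hlevel, Nat.card_eq_fintype_card, nsmul_eq_mul, one_div_pow]
  ring

end RootedGraph.Parents

/-! ### Double counting -/

theorem mainTheorem3 (α : ℝ≥0) (h : ℕ) (t : RootedGraph.{u}) [Finite t.V]
    (ht : t.graph.IsTree) (hh : ∀ x : t.V, t.height x ≤ h) :
    MeasurableSet {ω : (ℕ → List ℕ → ℕ) × ℕ∞ |
      ((spineTree ω.1 ω.2).trunc h).SameShape t} ∧
    spineTreeLaw α {ω : (ℕ → List ℕ → ℕ) × ℕ∞ |
      ((spineTree ω.1 ω.2).trunc h).SameShape t} =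
      ENNReal.ofReal
        ((((t.level h).ncard : ℝ) + (α : ℝ) * (Nat.card t.V : ℝ)) / (Nat.card t.Aut : ℝ)
          * (1 / (1 + (α : ℝ)) ^ Nat.card t.V)
          * Real.exp (-((t.below h).ncard : ℝ) / (1 + (α : ℝ)))) := by
  classical
  obtain ⟨P⟩ := t.nonempty_parents_of_isTree ht
  have hh : ∀ x, P.ht x ≤ h := fun x => by
    have := hh x
    rw [P.height_eq] at this
    exact_mod_cast this
  have := Fintype.ofFinite t.V
  have := Fintype.ofFinite (Σ v, P.Ranks v)
  set A : Set ((ℕ → List ℕ → ℕ) × ℕ∞) :=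
    {ω | ((spineTree ω.1 ω.2).trunc h).SameShape t}
  have hsum : ∀ ω, ∑ s, (P.labelEvent h s).indicator (1 : (ℕ → List ℕ → ℕ) × ℕ∞ → ℝ≥0∞) ω =
      A.indicator (fun _ => (Nat.card t.Aut : ℝ≥0∞)) ω := by
    intro ω
    have h1 : ∑ s, (P.labelEvent h s).indicator (1 : (ℕ → List ℕ → ℕ) × ℕ∞ → ℝ≥0∞) ω =
        (Nat.card (t.Iso ((spineTree ω.1 ω.2).trunc h)) : ℝ≥0∞) := by
      rw [RootedGraph.Parents.natCard_iso_eq hh, Nat.card_eq_fintype_card, Fintype.card_subtype]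
      simp only [Set.indicator_apply, Pi.one_apply, Finset.sum_boole]
    rw [h1]
    by_cases hω : ω ∈ A
    · rw [Set.indicator_of_mem hω, RootedGraph.natCard_iso_of_sameShape hω]
    · rw [Set.indicator_of_notMem hω]
      have := RootedGraph.isEmpty_iso_of_not_sameShape hω
      rw [Nat.card_of_isEmpty, Nat.cast_zero]
  have hpos : (0 : ℝ) < Nat.card t.Aut := by exact_mod_cast RootedGraph.Aut.card_pos t
  have hmeas : MeasurableSet A := by
    -- As `|Aut t| > 0`, the shapes agree exactly when some label event occurs.
    have hU : A = ⋃ s, P.labelEvent h s := by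
      ext ω
      rw [Set.mem_iUnion]
      constructor
      · intro hω
        by_contra hc
        push Not at hc
        have h1 := hsum ω
        rw [Finset.sum_eq_zero fun s _ => Set.indicator_of_notMem (hc s) _,
          Set.indicator_of_mem hω] at h1
        exact (RootedGraph.Aut.card_pos t).ne (by exact_mod_cast h1)
      · rintro ⟨s, hs⟩
        by_contra hc
        have h1 := hsum ω
        rw [Set.indicator_of_notMem hc, Finset.sum_eq_zero_iff] at h1
        have h2 := h1 s (Finset.mem_univ s)
        rw [Set.indicator_of_mem hs] at h2
        exact one_ne_zero h2
    rw [hU]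
    exact MeasurableSet.iUnion fun s => P.measurableSet_labelEvent h s
  refine ⟨hmeas, ?_⟩
  -- The label events overlap: on `A` exactly `|Aut t|` of them occur. Integrating this count gives
  -- the identity.
  have hint : (Nat.card t.Aut : ℝ≥0∞) * spineTreeLaw α A =
      ∑ s, spineTreeLaw α (P.labelEvent h s) := by
    rw [← lintegral_indicator_const hmeas, ← lintegral_congr hsum, lintegral_finsetSum]
    · exact Finset.sum_congr rfl fun s _ => lintegral_indicator_one (P.measurableSet_labelEvent h s)
    · exact fun s _ => measurable_one.indicator (P.measurableSet_labelEvent h s)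
  rw [P.sum_spineTreeLaw_labelEvent α hh] at hint
  have hne : (Nat.card t.Aut : ℝ≥0∞) ≠ 0 := by
    exact_mod_cast (RootedGraph.Aut.card_pos t).ne'
  rw [← ENNReal.mul_right_inj hne (ENNReal.natCast_ne_top _), hint, ← ENNReal.ofReal_natCast,
    ← ENNReal.ofReal_mul hpos.le]
  congr 1
  field_simp
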